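/- Let $Q$ be a smooth orbifold, not necessarily reduced: a Hausdorff space with a compatible cover by charts $\{V,G,\pi\}$, where $V$ is a connected open subset of $\mathbb R^n$, $G$ is a finite group acting smoothly (not necessarily effectively) on $V$, and $\pi$ induces a homeomorphism from $V/G$ onto an open subset of $Q$, together with the injections $i=(\varphi,\lambda):\{V_1,G_1,\pi_1\}\to\{V_2,G_2,\pi_2\}$ of charts. These are closed under composition and include the elements of $G$ as injections of $\{V,G,\pi\}$ into itself; any two injections between the same charts differ by a unique element of $G_2$. Let $\rho:E\to Q$ be a (good or bad) orbifold vector bundle with fibre $F\cong\mathbb R^k$, given by smooth transition maps $g_i:V_1\to \mathrm{AUT}(F)$, one for each injection $i$, with $g_{j\circ i}(x)=g_j(\varphi_i(x))\,g_i(x)$. Its total space $E$ is the orbifold with charts $\{V\times F,G,\tilde\pi\}$ and injections $(x,v)\mapsto(\varphi(x),g_i(x)v)$. Let $TE\to E$ be the orbifold tangent bundle, with transition maps the differentials of these injections. Call a vector of $TE$ vertical if each of its lifts to $T(V\times F)$, for each chart $V\times F$ of $E$, is annihilated by the differential of the projection $V\times F\to V$. Let $VE\to E$ be the subbundle of $TE$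 formed by the vertical vectors, and let $\iota:Q\to E$ be the zero section, an isomorphism of $Q$ onto the suborbifold $\iota(Q)$ of $E$. Then the restriction $VE_{|\iota(Q)}$ is naturally isomorphic to $E$. Precisely, for all such $Q$ and $E$ there are isomorphisms of orbifold vector bundles $\Phi_E:E\to VE_{|\iota(Q)}$ covering $\iota:Q\to\iota(Q)$, that is, fibrewise invertible smooth families of linear maps over the charts that commute with the transition maps of all injections, such that: 1. in each chart, $\Phi_E$ sends $(x,v)$ to the velocity at $t=0$ of the curve $t\mapsto(x,tv)$ in $V\times F$; 2. $\Phi_E$ induces a topological embedding of the total space of $E$ into that of $TE$, whose image is the set of all vertical vectors at points of $\iota(Q)$; 3. $\Phi_E$ is natural: if $T:E\to E'$ is a morphism of orbifold vector bundles over a map $f:Q\to Q'$ of orbifolds (with a compatible system of lifts), then in each chart the differential at $(x,0)$ of the map $(y,w)\mapsto(f(y),T_yw)$ of total spaces sends $\Phi_E(x,v)$ to $\Phi_{E'}(f(x),T_xv)$. -/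

import Mathlib

open Set Topology
open scoped ContDiff

universe u u' v v' w w' k k'

namespace Orbi

/-- An orbifold chart `{V, G, π}` on the space `X`: a connected open subset `V` of the (finite
dimensional) vector space `H`, a finite group `G` acting smoothly (not necessarily effectively)
on `V`, and a map `π : V → X` inducing a homeomorphism of `V / G` onto an open subset of `X`
(i.e. `π` is continuous and open and its fibres are exactly the `G`-orbits).
Maps between charts are given by functions on all of `H`, of which only the values on `V`
are relevant. -/
structure OrbifoldChart (H : Type u) [NormedAddCommGroup H] [NormedSpace ℝ H]
    (X : Type v) [TopologicalSpace X] where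
  V : Set H
  isOpen : IsOpen V
  isConnected : IsConnected V
  G : Type w
  [group : Group G]
  [finite : Finite G]
  act : G → H → H
  act_mapsTo : ∀ g, MapsTo (act g) V V
  act_smooth : ∀ g, ContDiffOn ℝ ∞ (act g) V
  act_one : ∀ x ∈ V, act 1 x = x
  act_mul : ∀ g h, ∀ x ∈ V, act (g * h) x = act g (act h x)
  π : V → X
  π_continuous : Continuous π
  π_isOpenMap : IsOpenMap π
  π_eq_iff : ∀ x y : V, π x = π y ↔ ∃ g, act g x = y

attribute [instance] OrbifoldChart.group OrbifoldChart.finite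

/-- An injection of orbifold charts: a smooth open embedding `φ` (`toFun`, an injective local
diffeomorphism) over the identity of `X`, and an injective homomorphism `λ` (`hom`) for which
`φ` is equivariant.  The field `full` is the usual requirement for charts that need not be
effective: `λ` restricts to an isomorphism from the kernel of the action of `A.G` onto the kernel
of the action of `B.G`, equivalently, `λ (A.G)` contains each element of `B.G` moving some point
of `φ (V)` to a point of `φ (V)`. -/
structure ChartInjection {H : Type u} [NormedAddCommGroup H] [NormedSpace ℝ H]
    {X : Type v} [TopologicalSpace X] (A B : OrbifoldChart.{u, v, w} H X) where
  toFun : H → H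
  hom : A.G →* B.G
  mapsTo : MapsTo toFun A.V B.V
  smooth : ContDiffOn ℝ ∞ toFun A.V
  injOn : InjOn toFun A.V
  invertible : ∀ x ∈ A.V, (fderiv ℝ toFun x).IsInvertible
  π_eq : ∀ x : A.V, B.π ⟨toFun x, mapsTo x.2⟩ = A.π x
  hom_injective : Function.Injective hom
  equivariant : ∀ g, ∀ x ∈ A.V, toFun (A.act g x) = B.act (hom g) (toFun x)
  full : ∀ h, ∀ x ∈ A.V, ∀ y ∈ A.V, B.act h (toFun x) = toFun y → ∃ g, hom g = h

/-- A (not necessarily reduced) smooth orbifold structure on the Hausdorff space `X`, modelled on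
the vector space `H`, given by a compatible cover by orbifold charts together with its injections.

`Inj a b` is the set of injections from the chart `a` to the chart `b`; injections can be
composed, each group element is an injection of its chart into itself (`ofG`), and any two
injections from `a` to `b` differ by a unique element of the group of `b`.  As the orbifold need
not be reduced, `Inj a b` is a set of labels: different injections may have the same underlying
pair `(φ, λ)` (for instance those given by central elements of a group which acts trivially). If
the orbifold is reduced, `Inj a b` is the set of all injections in the sense of
`ChartInjection`, as soon as it is nonempty. -/
structure Orbifold (H : Type u) [NormedAddCommGroup H] [NormedSpace ℝ H]
    (X : Type v) [TopologicalSpace X] where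
  t2 : T2Space X
  Index : Type w
  chart : Index → OrbifoldChart.{u, v, w} H X
  Inj : Index → Index → Type w
  inj : ∀ {a b}, Inj a b → ChartInjection (chart a) (chart b)
  comp : ∀ {a b c}, Inj b c → Inj a b → Inj a c
  inj_comp : ∀ {a b c} (j : Inj b c) (i : Inj a b), ∀ x ∈ (chart a).V,
    (inj (comp j i)).toFun x = (inj j).toFun ((inj i).toFun x)
  hom_comp : ∀ {a b c} (j : Inj b c) (i : Inj a b) (g : (chart a).G),
    (inj (comp j i)).hom g = (inj j).hom ((inj i).hom g)
  comp_assoc : ∀ {a b c d} (l : Inj c d) (j : Inj b c) (i : Inj a b),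
    comp (comp l j) i = comp l (comp j i)
  ofG : ∀ {a}, (chart a).G → Inj a a
  inj_ofG : ∀ {a} (g : (chart a).G), ∀ x ∈ (chart a).V,
    (inj (ofG g)).toFun x = (chart a).act g x
  hom_ofG : ∀ {a} (g h : (chart a).G), (inj (ofG g)).hom h = g * h * g⁻¹
  ofG_mul : ∀ {a} (g h : (chart a).G), ofG (g * h) = comp (ofG g) (ofG h)
  one_comp : ∀ {a b} (i : Inj a b), comp (ofG 1) i = i
  comp_ofG : ∀ {a b} (i : Inj a b) (g : (chart a).G),
    comp i (ofG g) = comp (ofG ((inj i).hom g)) i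
  torsor : ∀ {a b} (i j : Inj a b), ∃! g : (chart b).G, j = comp (ofG g) i
  cover : ∀ p : X, ∃ a, ∃ x : (chart a).V, (chart a).π x = p
  compatible : ∀ a b (x : (chart a).V) (y : (chart b).V), (chart a).π x = (chart b).π y →
    ∃ c, Nonempty (Inj c a) ∧ Nonempty (Inj c b) ∧ ∃ z : (chart c).V, (chart c).π z = (chart a).π x

/-- A smooth map of orbifolds, given together with a compatible system: it assigns to each chart
a chart and a smooth lift of the map, and to each injection an injection, compatibly with the
lifts, the groups and composition. -/
structure OrbifoldMap {H : Type u} [NormedAddCommGroup H] [NormedSpace ℝ H]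
    {X : Type v} [TopologicalSpace X] {H' : Type u'} [NormedAddCommGroup H'] [NormedSpace ℝ H']
    {X' : Type v'} [TopologicalSpace X']
    (Q : Orbifold.{u, v, w} H X) (Q' : Orbifold.{u', v', w'} H' X') where
  toFun : X → X'
  continuous : Continuous toFun
  index : Q.Index → Q'.Index
  lift : Q.Index → H → H'
  mapsTo : ∀ a, MapsTo (lift a) (Q.chart a).V (Q'.chart (index a)).V
  smooth : ∀ a, ContDiffOn ℝ ∞ (lift a) (Q.chart a).V
  π_lift : ∀ a (x : (Q.chart a).V),
    (Q'.chart (index a)).π ⟨lift a x, mapsTo a x.2⟩ = toFun ((Q.chart a).π x)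
  inj : ∀ {a b}, Q.Inj a b → Q'.Inj (index a) (index b)
  grp : ∀ a, (Q.chart a).G →* (Q'.chart (index a)).G
  inj_comp : ∀ {a b c} (j : Q.Inj b c) (i : Q.Inj a b),
    inj (Q.comp j i) = Q'.comp (inj j) (inj i)
  inj_ofG : ∀ a (g : (Q.chart a).G), inj (Q.ofG g) = Q'.ofG (grp a g)
  lift_inj : ∀ {a b} (i : Q.Inj a b), ∀ x ∈ (Q.chart a).V,
    lift b ((Q.inj i).toFun x) = (Q'.inj (inj i)).toFun (lift a x)

/-- The orbifold map is a diffeomorphism which identifies the charts, groups and injections of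
the two orbifolds. -/
structure OrbifoldMap.IsIso {H : Type u} [NormedAddCommGroup H] [NormedSpace ℝ H]
    {X : Type v} [TopologicalSpace X] {H' : Type u'} [NormedAddCommGroup H'] [NormedSpace ℝ H']
    {X' : Type v'} [TopologicalSpace X']
    {Q : Orbifold.{u, v, w} H X} {Q' : Orbifold.{u', v', w'} H' X'}
    (f : OrbifoldMap Q Q') : Prop where
  isHomeomorph : IsHomeomorph f.toFun
  index_bijective : Function.Bijective f.index
  lift_bijOn : ∀ a, BijOn (f.lift a) (Q.chart a).V (Q'.chart (f.index a)).V
  lift_invertible : ∀ a, ∀ x ∈ (Q.chart a).V, (fderiv ℝ (f.lift a) x).IsInvertible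
  grp_bijective : ∀ a, Function.Bijective (f.grp a)
  inj_bijective : ∀ a b, Function.Bijective (f.inj (a := a) (b := b))

/-- An orbifold vector bundle over `Q` with fibre `F`, given by its transition maps
`g i : V₁ → AUT(F)`, one for each injection `i` of the charts of `Q`.  As the elements of the
group of a chart are injections, this contains the action
`γ (x, v) = (γ x, g (ofG γ) x v)` of the group on `V × F`.  It may be bad, i.e. group elements
acting trivially on `V` may act nontrivially on the fibres. -/
structure Bundle {H : Type u} [NormedAddCommGroup H] [NormedSpace ℝ H]
    {X : Type v} [TopologicalSpace X] (Q : Orbifold.{u, v, w} H X)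
    (F : Type k) [NormedAddCommGroup F] [NormedSpace ℝ F] where
  g : ∀ {a b}, Q.Inj a b → H → F →L[ℝ] F
  smooth : ∀ {a b} (i : Q.Inj a b), ContDiffOn ℝ ∞ (g i) (Q.chart a).V
  invertible : ∀ {a b} (i : Q.Inj a b), ∀ x ∈ (Q.chart a).V, (g i x).IsInvertible
  cocycle : ∀ {a b c} (j : Q.Inj b c) (i : Q.Inj a b), ∀ x ∈ (Q.chart a).V,
    g (Q.comp j i) x = (g j ((Q.inj i).toFun x)).comp (g i x)

/-- A morphism of orbifold vector bundles covering a map `f` of orbifolds: smooth families of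
linear maps over the charts, commuting with all transition maps. -/
structure BundleMap {H : Type u} [NormedAddCommGroup H] [NormedSpace ℝ H]
    {X : Type v} [TopologicalSpace X] {Q : Orbifold.{u, v, w} H X}
    {F : Type k} [NormedAddCommGroup F] [NormedSpace ℝ F]
    {H' : Type u'} [NormedAddCommGroup H'] [NormedSpace ℝ H']
    {X' : Type v'} [TopologicalSpace X'] {Q' : Orbifold.{u', v', w'} H' X'}
    {F' : Type k'} [NormedAddCommGroup F'] [NormedSpace ℝ F']
    (E : Bundle Q F) (E' : Bundle Q' F') (f : OrbifoldMap Q Q') where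
  fib : Q.Index → H → F →L[ℝ] F'
  smooth : ∀ a, ContDiffOn ℝ ∞ (fib a) (Q.chart a).V
  comm : ∀ {a b} (i : Q.Inj a b), ∀ x ∈ (Q.chart a).V,
    (fib b ((Q.inj i).toFun x)).comp (E.g i x) = (E'.g (f.inj i) (f.lift a x)).comp (fib a x)

/-- The bundle morphism is an isomorphism of orbifold vector bundles: it covers an isomorphism
of the bases and is an isomorphism on each fibre. -/
structure BundleMap.IsIso {H : Type u} [NormedAddCommGroup H] [NormedSpace ℝ H]
    {X : Type v} [TopologicalSpace X] {Q : Orbifold.{u, v, w} H X}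
    {F : Type k} [NormedAddCommGroup F] [NormedSpace ℝ F]
    {H' : Type u'} [NormedAddCommGroup H'] [NormedSpace ℝ H']
    {X' : Type v'} [TopologicalSpace X'] {Q' : Orbifold.{u', v', w'} H' X'}
    {F' : Type k'} [NormedAddCommGroup F'] [NormedSpace ℝ F']
    {E : Bundle Q F} {E' : Bundle Q' F'} {f : OrbifoldMap Q Q'} (T : BundleMap E E' f) :
    Prop where
  base : f.IsIso
  fib_invertible : ∀ a, ∀ x ∈ (Q.chart a).V, (T.fib a x).IsInvertible

section Basic

variable {H : Type u} [NormedAddCommGroup H] [NormedSpace ℝ H]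
  {X : Type v} [TopologicalSpace X] {Q : Orbifold.{u, v, w} H X}
  {F : Type k} [NormedAddCommGroup F] [NormedSpace ℝ F]

/-- The pullback of a bundle by a map of orbifolds with its compatible system. -/
def Bundle.pullback {H' : Type u'} [NormedAddCommGroup H'] [NormedSpace ℝ H']
    {X' : Type v'} [TopologicalSpace X'] {Q' : Orbifold.{u', v', w'} H' X'}
    (E : Bundle Q' F) (f : OrbifoldMap Q Q') : Bundle Q F where
  g i x := E.g (f.inj i) (f.lift _ x)
  smooth {a _} i := (E.smooth (f.inj i)).comp (f.smooth a) (f.mapsTo a)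
  invertible {a _} i x hx := E.invertible _ _ (f.mapsTo a hx)
  cocycle {a _ _} j i x hx := by
    rw [f.inj_comp, E.cocycle _ _ _ (f.mapsTo a hx), f.lift_inj i x hx]

/-- The tangent bundle of an orbifold: its transition maps are the differentials of the
injections. -/
noncomputable def tangentBundle (Q : Orbifold.{u, v, w} H X) : Bundle Q H where
  g i x := fderiv ℝ (Q.inj i).toFun x
  smooth {a _} i := (Q.inj i).smooth.fderiv_of_isOpen (Q.chart a).isOpen (by simp)
  invertible i x hx := (Q.inj i).invertible x hx
  cocycle {a b c} j i x hx := by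
    have hd : ∀ {a b} (i : Q.Inj a b), ∀ x ∈ (Q.chart a).V,
        DifferentiableAt ℝ (Q.inj i).toFun x := fun {a b} i x hx =>
      ((Q.inj i).smooth.contDiffAt ((Q.chart a).isOpen.mem_nhds hx)).differentiableAt (by simp)
    rw [← fderiv_comp x (hd j _ ((Q.inj i).mapsTo hx)) (hd i x hx)]
    apply Filter.EventuallyEq.fderiv_eq
    filter_upwards [(Q.chart a).isOpen.mem_nhds hx] with y hy
    exact Q.inj_comp j i y hy

namespace Bundle

variable (E : Bundle Q F)

/-- The disjoint union of the products `V × F` over all charts. -/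
abbrev Pre (_E : Bundle Q F) : Type (max u w k) := Σ a : Q.Index, (Q.chart a).V × F

/-- Two points of the disjoint union are identified when they are images of one point
under injections `(x, v) ↦ (φ x, g_i(x) v)`. -/
def Rel (p q : E.Pre) : Prop :=
  ∃ (c : Q.Index) (i : Q.Inj c p.1) (j : Q.Inj c q.1) (z : (Q.chart c).V) (s : F),
    (Q.inj i).toFun z = p.2.1 ∧ E.g i z s = p.2.2 ∧
    (Q.inj j).toFun z = q.2.1 ∧ E.g j z s = q.2.2

theorem g_injective {a b} (i : Q.Inj a b) {x : H} (hx : x ∈ (Q.chart a).V) :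
    Function.Injective (E.g i x) := by
  obtain ⟨A, hA⟩ := E.invertible i x hx
  rw [← hA]
  exact A.injective

theorem g_surjective {a b} (i : Q.Inj a b) {x : H} (hx : x ∈ (Q.chart a).V) :
    Function.Surjective (E.g i x) := by
  obtain ⟨A, hA⟩ := E.invertible i x hx
  rw [← hA]
  exact A.surjective

theorem g_comp {a b c} (j : Q.Inj b c) (i : Q.Inj a b) {x : H} (hx : x ∈ (Q.chart a).V) (s : F) :
    E.g (Q.comp j i) x s = E.g j ((Q.inj i).toFun x) (E.g i x s) := by
  rw [E.cocycle j i x hx]; rfl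

theorem inj_ofG_one {a} {x : H} (hx : x ∈ (Q.chart a).V) :
    (Q.inj (Q.ofG (1 : (Q.chart a).G))).toFun x = x := by
  rw [Q.inj_ofG 1 x hx, (Q.chart a).act_one x hx]

theorem g_ofG_one {a} {x : H} (hx : x ∈ (Q.chart a).V) (s : F) :
    E.g (Q.ofG (1 : (Q.chart a).G)) x s = s := by
  apply E.g_injective (Q.ofG (1 : (Q.chart a).G)) hx
  have h := E.g_comp (Q.ofG (1 : (Q.chart a).G)) (Q.ofG 1) hx s
  rw [inj_ofG_one hx, Q.one_comp] at h
  exact h.symm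

theorem rel_refl (p : E.Pre) : E.Rel p p :=
  ⟨p.1, Q.ofG 1, Q.ofG 1, p.2.1, p.2.2, inj_ofG_one p.2.1.2, E.g_ofG_one p.2.1.2 _,
    inj_ofG_one p.2.1.2, E.g_ofG_one p.2.1.2 _⟩

theorem rel_symm {p q : E.Pre} (h : E.Rel p q) : E.Rel q p := by
  obtain ⟨c, i, j, z, s, h1, h2, h3, h4⟩ := h
  exact ⟨c, j, i, z, s, h3, h4, h1, h2⟩

/-- Any point over a chart `a` can be reached by an injection from a chart around it. -/
theorem exists_inj_through {a c} (m : Q.Inj c a) (z : (Q.chart c).V) (x : (Q.chart a).V)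
    (h : (Q.chart c).π z = (Q.chart a).π x) : ∃ m' : Q.Inj c a, (Q.inj m').toFun z = x := by
  rw [← (Q.inj m).π_eq z] at h
  obtain ⟨g, hg⟩ := ((Q.chart a).π_eq_iff _ _).1 h
  refine ⟨Q.comp (Q.ofG g) m, ?_⟩
  rw [Q.inj_comp _ _ _ z.2, Q.inj_ofG _ _ ((Q.inj m).mapsTo z.2)]
  exact hg

theorem exists_common {a b} (x : (Q.chart a).V) (y : (Q.chart b).V)
    (h : (Q.chart a).π x = (Q.chart b).π y) :
    ∃ (c : Q.Index) (i : Q.Inj c a) (j : Q.Inj c b) (z : (Q.chart c).V),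
      (Q.inj i).toFun z = x ∧ (Q.inj j).toFun z = y := by
  obtain ⟨c, ⟨i⟩, ⟨j⟩, z, hz⟩ := Q.compatible a b x y h
  obtain ⟨i', hi⟩ := exists_inj_through i z x hz
  obtain ⟨j', hj⟩ := exists_inj_through j z y (hz.trans h)
  exact ⟨c, i', j', z, hi, hj⟩

theorem π_eq_of_inj {a c} (i : Q.Inj c a) {z : (Q.chart c).V} {x : (Q.chart a).V}
    (h : (Q.inj i).toFun z = x) : (Q.chart a).π x = (Q.chart c).π z := by
  rw [← (Q.inj i).π_eq z]
  congr 1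
  exact Subtype.ext h.symm

theorem rel_trans {p q r : E.Pre} (h : E.Rel p q) (h' : E.Rel q r) : E.Rel p r := by
  obtain ⟨c, i, j, z, s, h1, h2, h3, h4⟩ := h
  obtain ⟨c', i', j', z', s', h1', h2', h3', h4'⟩ := h'
  obtain ⟨d, m, m', t, hm, hm'⟩ := exists_common z z'
    ((π_eq_of_inj j h3).symm.trans (π_eq_of_inj i' h1'))
  obtain ⟨h, hh, -⟩ := Q.torsor (Q.comp j m) (Q.comp i' m')
  have e1 : (Q.inj (Q.comp j m)).toFun t = q.2.1 := by rw [Q.inj_comp _ _ _ t.2, hm, h3]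
  have e2 : (Q.inj (Q.comp i' m')).toFun t = q.2.1 := by rw [Q.inj_comp _ _ _ t.2, hm', h1']
  have e3 : (Q.chart q.1).act h ((Q.inj (Q.comp j m)).toFun t) =
      (Q.inj (Q.comp j m)).toFun t := by
    conv_rhs => rw [e1, ← e2, hh]
    rw [Q.inj_comp _ (Q.comp j m) _ t.2, Q.inj_ofG _ _ ((Q.inj _).mapsTo t.2)]
  obtain ⟨γ, hγ⟩ := (Q.inj (Q.comp j m)).full h t t.2 t t.2 e3
  have hγt : (Q.inj (Q.ofG γ)).toFun t = t := by
    rw [Q.inj_ofG _ _ t.2]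
    apply (Q.inj (Q.comp j m)).injOn ((Q.chart d).act_mapsTo γ t.2) t.2
    rw [(Q.inj (Q.comp j m)).equivariant γ t t.2, hγ, e3]
  have key : Q.comp i' m' = Q.comp (Q.comp j m) (Q.ofG γ) := by rw [hh, Q.comp_ofG, hγ]
  obtain ⟨σ, hσ⟩ := E.g_surjective m' t.2 s'
  have h5 : E.g (Q.comp i' m') t σ = q.2.2 := by rw [E.g_comp _ _ t.2, hm', hσ, h2']
  rw [key, E.g_comp _ _ t.2, hγt, E.g_comp _ _ t.2, hm, ← h4] at h5
  have h6 := E.g_injective j z.2 h5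
  refine ⟨d, Q.comp i (Q.comp m (Q.ofG γ)), Q.comp j' m', t, σ, ?_, ?_, ?_, ?_⟩
  · rw [Q.inj_comp _ _ _ t.2, Q.inj_comp _ _ _ t.2, hγt, hm, h1]
  · rw [E.g_comp _ _ t.2, Q.inj_comp _ _ _ t.2, hγt, hm, E.g_comp _ _ t.2, hγt, h6, h2]
  · rw [Q.inj_comp _ _ _ t.2, hm', h3']
  · rw [E.g_comp _ _ t.2, hm', hσ, h4']

def setoid : Setoid E.Pre := ⟨E.Rel, E.rel_refl, E.rel_symm, E.rel_trans⟩

/-- The total space of the bundle, with the quotient topology. -/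
def Total : Type (max u w k) := Quotient E.setoid

instance : TopologicalSpace E.Total := inferInstanceAs (TopologicalSpace (Quotient E.setoid))

/-- The point of the total space represented by `(x, v)` in the chart `a`. -/
def pt (a : Q.Index) (x : (Q.chart a).V) (v : F) : E.Total := Quotient.mk E.setoid ⟨a, x, v⟩

theorem pt_eq_iff {a b} {x : (Q.chart a).V} {y : (Q.chart b).V} {v w : F} :
    E.pt a x v = E.pt b y w ↔ E.Rel ⟨a, x, v⟩ ⟨b, y, w⟩ :=
  Quotient.eq (r := E.setoid)

/-- The projection `ρ : E → Q`. -/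
def proj : E.Total → X :=
  Quotient.lift (fun p : E.Pre => (Q.chart p.1).π p.2.1) (by
    rintro p q ⟨c, i, j, z, s, h1, -, h3, -⟩
    exact (π_eq_of_inj i h1).trans (π_eq_of_inj j h3).symm)

theorem proj_continuous : Continuous E.proj := by
  apply Continuous.quotient_lift
  exact continuous_sigma fun a => (Q.chart a).π_continuous.comp continuous_fst

theorem pt_continuous (a : Q.Index) :
    Continuous (fun p : (Q.chart a).V × F => E.pt a p.1 p.2) :=
  continuous_quotient_mk'.comp
    (continuous_sigmaMk (σ := fun a : Q.Index => (Q.chart a).V × F) (i := a))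

theorem pt_zero_eq {a b} (x : (Q.chart a).V) (y : (Q.chart b).V)
    (h : (Q.chart a).π x = (Q.chart b).π y) : E.pt a x 0 = E.pt b y 0 := by
  obtain ⟨c, i, j, z, hi, hj⟩ := exists_common x y h
  exact E.pt_eq_iff.2 ⟨c, i, j, z, 0, hi, map_zero _, hj, map_zero _⟩

/-- The zero section `ι : Q → E`; it is given by `x ↦ (x, 0)` in each chart, see
`zero_π`. -/
noncomputable def zero (p : X) : E.Total :=
  E.pt (Q.cover p).choose (Q.cover p).choose_spec.choose 0

theorem zero_π (a : Q.Index) (x : (Q.chart a).V) : E.zero ((Q.chart a).π x) = E.pt a x 0 :=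
  E.pt_zero_eq _ _ (Q.cover ((Q.chart a).π x)).choose_spec.choose_spec

theorem proj_zero (p : X) : E.proj (E.zero p) = p := (Q.cover p).choose_spec.choose_spec

theorem zero_continuous : Continuous E.zero := by
  rw [continuous_iff_continuousAt]
  intro p
  obtain ⟨a, x, rfl⟩ := Q.cover p
  have h : Filter.Tendsto (E.zero ∘ (Q.chart a).π) (𝓝 x) (𝓝 (E.zero ((Q.chart a).π x))) := by
    have e : E.zero ∘ (Q.chart a).π = fun y => E.pt a y 0 := funext fun y => E.zero_π a y
    rw [e, E.zero_π]
    exact ((E.pt_continuous a).comp (Continuous.prodMk_left (0 : F))).tendsto x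
  rw [ContinuousAt]
  intro s hs
  have h2 := (Q.chart a).π_isOpenMap.image_mem_nhds (h hs)
  refine Filter.mem_map.2 (Filter.mem_of_superset h2 ?_)
  rintro _ ⟨y, hy, rfl⟩
  exact hy

theorem zero_isEmbedding : IsEmbedding E.zero :=
  IsEmbedding.of_leftInverse E.proj_zero E.proj_continuous E.zero_continuous

/-- The map `(x, v) ↦ (φ x, g_i(x) v)` associated with an injection `i`. -/
def injFun {a b} (i : Q.Inj a b) (p : H × F) : H × F := ((Q.inj i).toFun p.1, E.g i p.1 p.2)

/-- The set `V × F`. -/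
def totV (_E : Bundle Q F) (a : Q.Index) : Set (H × F) := {p | p.1 ∈ (Q.chart a).V}

theorem totV_isOpen (a : Q.Index) : IsOpen (E.totV a) :=
  (Q.chart a).isOpen.preimage continuous_fst

theorem injFun_mapsTo {a b} (i : Q.Inj a b) : MapsTo (E.injFun i) (E.totV a) (E.totV b) :=
  fun _ hp => (Q.inj i).mapsTo hp

theorem injFun_smooth {a b} (i : Q.Inj a b) : ContDiffOn ℝ ∞ (E.injFun i) (E.totV a) := by
  have hm : MapsTo Prod.fst (E.totV a) (Q.chart a).V := fun _ hp => hp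
  exact ((Q.inj i).smooth.comp contDiff_fst.contDiffOn hm).prodMk
    (((E.smooth i).comp contDiff_fst.contDiffOn hm).clm_apply contDiff_snd.contDiffOn)

theorem injFun_injOn {a b} (i : Q.Inj a b) : InjOn (E.injFun i) (E.totV a) := by
  rintro ⟨x, v⟩ hx ⟨y, w⟩ hy h
  simp only [injFun, Prod.mk.injEq] at h
  obtain rfl : x = y := (Q.inj i).injOn hx hy h.1
  rw [E.g_injective i hx h.2]

theorem injFun_invertible {a b} (i : Q.Inj a b) : ∀ p ∈ E.totV a,
    (fderiv ℝ (E.injFun i) p).IsInvertible := by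
  rintro ⟨x, v⟩ hx
  change x ∈ (Q.chart a).V at hx
  have hn := (Q.chart a).isOpen.mem_nhds hx
  have d1 : HasFDerivAt (Q.inj i).toFun (fderiv ℝ (Q.inj i).toFun x) x :=
    (((Q.inj i).smooth.contDiffAt hn).differentiableAt (by simp)).hasFDerivAt
  have d2 : HasFDerivAt (E.g i) (fderiv ℝ (E.g i) x) x :=
    (((E.smooth i).contDiffAt hn).differentiableAt (by simp)).hasFDerivAt
  obtain ⟨A, hA⟩ := (Q.inj i).invertible x hx
  obtain ⟨B, hB⟩ := E.invertible i x hx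
  have f1 : HasFDerivAt (Prod.fst : H × F → H) (ContinuousLinearMap.fst ℝ H F) (x, v) :=
    hasFDerivAt_fst
  have f2 : HasFDerivAt (Prod.snd : H × F → F) (ContinuousLinearMap.snd ℝ H F) (x, v) :=
    hasFDerivAt_snd
  have e1 : HasFDerivAt (fun p : H × F => (Q.inj i).toFun p.1) _ (x, v) := d1.comp (x, v) f1
  have e2 : HasFDerivAt (fun p : H × F => E.g i p.1) _ (x, v) := d2.comp (x, v) f1
  have D : HasFDerivAt (E.injFun i) _ (x, v) := e1.prodMk (e2.clm_apply f2)
  rw [D.fderiv]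
  refine ⟨A.skewProd B ((fderiv ℝ (E.g i) x).flip v), ?_⟩
  ext q
  all_goals simp [← hA, ← hB]

theorem injFun_comp {a b c} (j : Q.Inj b c) (i : Q.Inj a b) : ∀ p ∈ E.totV a,
    E.injFun (Q.comp j i) p = E.injFun j (E.injFun i p) := by
  intro p hp
  exact Prod.ext (Q.inj_comp j i p.1 hp) (E.g_comp j i hp p.2)

theorem injFun_isOpen [FiniteDimensional ℝ H] [FiniteDimensional ℝ F] {a b} (i : Q.Inj a b)
    {W : Set (H × F)} (hW : IsOpen W) (hWV : W ⊆ E.totV a) : IsOpen (E.injFun i '' W) := by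
  have : CompleteSpace H := FiniteDimensional.complete ℝ H
  have : CompleteSpace F := FiniteDimensional.complete ℝ F
  rw [isOpen_iff_mem_nhds]
  rintro _ ⟨p, hp, rfl⟩
  obtain ⟨A, hA⟩ := E.injFun_invertible i p (hWV hp)
  have hs := ((E.injFun_smooth i).contDiffAt
    ((E.totV_isOpen a).mem_nhds (hWV hp))).hasStrictFDerivAt (by simp)
  rw [← hA] at hs
  rw [← hs.map_nhds_eq_of_equiv]
  exact Filter.image_mem_map (hW.mem_nhds hp)

theorem pt_eq_self_iff {a} {x y : (Q.chart a).V} {v w : F} :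
    E.pt a x v = E.pt a y w ↔
      ∃ g : (Q.chart a).G, E.injFun (Q.ofG g) ((x : H), v) = ((y : H), w) := by
  rw [pt_eq_iff]
  constructor
  · rintro ⟨c, i, j, z, s, h1, h2, h3, h4⟩
    obtain ⟨g, hg, -⟩ := Q.torsor i j
    refine ⟨g, ?_⟩
    dsimp only at h1 h2 h3 h4
    have := E.injFun_comp (Q.ofG g) i ((z : H), s) z.2
    rw [← hg] at this
    have e1 : E.injFun i ((z : H), s) = (↑x, v) := Prod.ext h1 h2
    have e2 : E.injFun j ((z : H), s) = (↑y, w) := Prod.ext h3 h4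
    rw [← e1, ← this, e2]
  · rintro ⟨g, hg⟩
    exact ⟨a, Q.ofG 1, Q.ofG g, x, v, inj_ofG_one x.2, E.g_ofG_one x.2 _,
      congrArg Prod.fst hg, congrArg Prod.snd hg⟩

theorem pt_isOpenMap [FiniteDimensional ℝ H] [FiniteDimensional ℝ F] (a : Q.Index) :
    IsOpenMap (fun p : E.totV a => E.pt a ⟨p.1.1, p.2⟩ p.1.2) := by
  intro W hW
  have hq : IsOpen (Quotient.mk E.setoid ⁻¹'
      ((fun p : E.totV a => E.pt a ⟨p.1.1, p.2⟩ p.1.2) '' W)) := by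
    rw [isOpen_sigma_iff]
    intro b
    have hWo : IsOpen (Subtype.val '' W : Set (H × F)) :=
      (E.totV_isOpen a).isOpenMap_subtype_val W hW
    have hU : IsOpen (⋃ (c : Q.Index) (i : Q.Inj c a) (j : Q.Inj c b),
        E.injFun j '' (E.totV c ∩ E.injFun i ⁻¹' (Subtype.val '' W))) := by
      refine isOpen_iUnion fun c => isOpen_iUnion fun i => isOpen_iUnion fun j => ?_
      exact E.injFun_isOpen j ((E.injFun_smooth i).continuousOn.isOpen_inter_preimage
        (E.totV_isOpen c) hWo) inter_subset_left
    have hc : Continuous (fun p : (Q.chart b).V × F => ((p.1 : H), p.2)) := by fun_prop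
    convert hU.preimage hc using 1
    ext ⟨y, w⟩
    simp only [mem_preimage, mem_image, mem_iUnion]
    constructor
    · rintro ⟨⟨⟨x, v⟩, hx⟩, hxW, h⟩
      obtain ⟨c, i, j, z, s, h1, h2, h3, h4⟩ := E.pt_eq_iff.1 h
      exact ⟨c, i, j, ((z : H), s), ⟨z.2, ⟨⟨(x, v), hx⟩, hxW, (Prod.ext h1 h2).symm⟩⟩,
        Prod.ext h3 h4⟩
    · rintro ⟨c, i, j, ⟨z, s⟩, ⟨hz, ⟨⟨x, v⟩, hx⟩, hxW, h⟩, h'⟩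
      refine ⟨⟨(x, v), hx⟩, hxW, E.pt_eq_iff.2 ⟨c, i, j, ⟨z, hz⟩, s, ?_, ?_, ?_, ?_⟩⟩
      · exact (congrArg Prod.fst h).symm
      · exact (congrArg Prod.snd h).symm
      · exact congrArg Prod.fst h'
      · exact congrArg Prod.snd h'
  exact hq

theorem exists_rep {a} (x : (Q.chart a).V) (e : E.Total) (h : E.proj e = (Q.chart a).π x) :
    ∃ v, e = E.pt a x v := by
  induction e using Quotient.inductionOn with
  | h p =>
    obtain ⟨b, y, w⟩ := p
    obtain ⟨c, i, j, z, hi, hj⟩ := exists_common y x h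
    obtain ⟨s, hs⟩ := E.g_surjective i z.2 w
    exact ⟨E.g j z s, E.pt_eq_iff.2 ⟨c, i, j, z, s, hi, hs, hj, rfl⟩⟩

theorem t2 [FiniteDimensional ℝ H] [FiniteDimensional ℝ F] : T2Space E.Total := by
  have := Q.t2
  refine ⟨fun e e' hne => ?_⟩
  by_cases hp : E.proj e = E.proj e'
  · obtain ⟨a, x, hx⟩ := Q.cover (E.proj e)
    obtain ⟨v, rfl⟩ := E.exists_rep x e hx.symm
    obtain ⟨v', rfl⟩ := E.exists_rep x e' (hp.symm.trans hx.symm)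
    have hg : ∀ g : (Q.chart a).G, E.injFun (Q.ofG g) ((x : H), v) ≠ ((x : H), v') := fun g h =>
      hne (E.pt_eq_self_iff.2 ⟨g, h⟩)
    have hd : ∀ g : (Q.chart a).G, Disjoint (𝓝 (E.injFun (Q.ofG g) ((x : H), v)))
        (𝓝 ((x : H), v')) := fun g => disjoint_nhds_nhds.2 (hg g)
    choose A hA B hB hAB using fun g => Filter.disjoint_iff.1 (hd g)
    have hcont : ∀ g : (Q.chart a).G,
        ContinuousAt (E.injFun (Q.ofG g)) ((x : H), v) := fun g =>
      ((E.injFun_smooth (Q.ofG g)).contDiffAt ((E.totV_isOpen a).mem_nhds x.2)).continuousAt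
    have hW : (⋂ g, E.injFun (Q.ofG g) ⁻¹' A g) ∈ 𝓝 ((x : H), v) :=
      Filter.iInter_mem.2 fun g => hcont g (hA g)
    have hW' : (⋂ g, B g) ∈ 𝓝 ((x : H), v') := Filter.iInter_mem.2 hB
    have n1 : (fun p : E.totV a => E.pt a ⟨p.1.1, p.2⟩ p.1.2) ''
        (Subtype.val ⁻¹' (⋂ g, E.injFun (Q.ofG g) ⁻¹' A g)) ∈ 𝓝 (E.pt a x v) :=
      (E.pt_isOpenMap a).image_mem_nhds (x := ⟨((x : H), v), x.2⟩)
        (continuous_subtype_val.continuousAt hW)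
    have n2 : (fun p : E.totV a => E.pt a ⟨p.1.1, p.2⟩ p.1.2) ''
        (Subtype.val ⁻¹' (⋂ g, B g)) ∈ 𝓝 (E.pt a x v') :=
      (E.pt_isOpenMap a).image_mem_nhds (x := ⟨((x : H), v'), x.2⟩)
        (continuous_subtype_val.continuousAt hW')
    have hdis : Disjoint (𝓝 (E.pt a x v)) (𝓝 (E.pt a x v')) := by
      refine Filter.disjoint_iff.2 ⟨_, n1, _, n2, ?_⟩
      rw [Set.disjoint_left]
      rintro _ ⟨⟨p, hp⟩, hpA, rfl⟩ ⟨⟨q, hq⟩, hqB, h⟩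
      obtain ⟨g, hg⟩ := (E.pt_eq_self_iff (x := ⟨p.1, hp⟩) (y := ⟨q.1, hq⟩)).1 h.symm
      have hpA' := mem_iInter.1 hpA g
      have hqB' := mem_iInter.1 hqB g
      have hq' : q ∈ A g := by
        have e : E.injFun (Q.ofG g) p = q := hg
        rw [← e]; exact hpA'
      exact Set.disjoint_left.1 (hAB g) hq' hqB'
    exact t2_separation_nhds_aux hdis
  · obtain ⟨U, W, hU, hW, h1, h2, h3⟩ := t2_separation hp
    exact ⟨_, _, hU.preimage E.proj_continuous, hW.preimage E.proj_continuous, h1, h2,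
      h3.preimage _⟩
where
  t2_separation_nhds_aux {e e' : E.Total} (h : Disjoint (𝓝 e) (𝓝 e')) :
      ∃ u v : Set E.Total, IsOpen u ∧ IsOpen v ∧ e ∈ u ∧ e' ∈ v ∧ Disjoint u v := by
    obtain ⟨u, ⟨hu, hu'⟩, v, ⟨hv, hv'⟩, h⟩ :=
      ((nhds_basis_opens e).disjoint_iff (nhds_basis_opens e')).1 h
    exact ⟨u, v, hu', hv', hu, hv, h⟩

section

variable [FiniteDimensional ℝ H] [FiniteDimensional ℝ F]

/-- The chart `{V × F, G, π̃}` of the total space induced by a chart `{V, G, π}` of the base. -/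
abbrev totalChart (a : Q.Index) : OrbifoldChart.{max u k, max u w k, w} (H × F) E.Total where
  V := E.totV a
  isOpen := E.totV_isOpen a
  isConnected := by
    have : E.totV a = (Q.chart a).V ×ˢ univ := by ext; simp [totV]
    rw [this]
    exact (Q.chart a).isConnected.prod isConnected_univ
  G := (Q.chart a).G
  act g := E.injFun (Q.ofG g)
  act_mapsTo g := E.injFun_mapsTo _
  act_smooth g := E.injFun_smooth _
  act_one x hx := Prod.ext (inj_ofG_one hx) (E.g_ofG_one hx _)
  act_mul g h x hx := by rw [Q.ofG_mul, E.injFun_comp _ _ x hx]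
  π p := E.pt a ⟨p.1.1, p.2⟩ p.1.2
  π_continuous := (E.pt_continuous a).comp
    ((continuous_fst.comp continuous_subtype_val).subtype_mk _ |>.prodMk
      (continuous_snd.comp continuous_subtype_val))
  π_isOpenMap := E.pt_isOpenMap a
  π_eq_iff _ _ := E.pt_eq_self_iff

/-- The injection `i_E = (φ_E, λ)` of charts of the total space,
`φ_E (x, v) = (φ x, g_i(x) v)`. -/
abbrev totalInj {a b} (i : Q.Inj a b) : ChartInjection (E.totalChart a) (E.totalChart b) where
  toFun := E.injFun i
  hom := (Q.inj i).hom
  mapsTo := E.injFun_mapsTo i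
  smooth := E.injFun_smooth i
  injOn := E.injFun_injOn i
  invertible := E.injFun_invertible i
  π_eq p := E.pt_eq_iff.2 ⟨a, i, Q.ofG 1, ⟨p.1.1, p.2⟩, p.1.2, rfl, rfl, inj_ofG_one p.2,
    E.g_ofG_one p.2 _⟩
  hom_injective := (Q.inj i).hom_injective
  equivariant g p hp := by
    have h1 := E.injFun_comp i (Q.ofG (a := a) g) p hp
    rw [Q.comp_ofG] at h1
    exact h1.symm.trans (E.injFun_comp _ i p hp)
  full h p hp q hq hpq := by
    have h1 := Q.inj_ofG (a := b) h _ ((Q.inj i).mapsTo hp)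
    exact (Q.inj i).full h p.1 hp q.1 hq (h1.symm.trans (congrArg Prod.fst hpq))

/-- The total space of an orbifold vector bundle as an orbifold. -/
abbrev total : Orbifold.{max u k, max u w k, w} (H × F) E.Total where
  t2 := E.t2
  Index := Q.Index
  chart := E.totalChart
  Inj := Q.Inj
  inj := E.totalInj
  comp := Q.comp
  inj_comp j i p hp := E.injFun_comp j i p hp
  hom_comp := Q.hom_comp
  comp_assoc := Q.comp_assoc
  ofG := Q.ofG
  inj_ofG _ _ _ := rfl
  hom_ofG := Q.hom_ofG
  ofG_mul := Q.ofG_mul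
  one_comp := Q.one_comp
  comp_ofG := Q.comp_ofG
  torsor := Q.torsor
  cover e := by
    induction e using Quotient.inductionOn with
    | h p => exact ⟨p.1, ⟨(p.2.1, p.2.2), p.2.1.2⟩, rfl⟩
  compatible a b p q h := by
    obtain ⟨c, i, j, z, s, h1, h2, -, -⟩ := E.pt_eq_iff.1 h
    refine ⟨c, ⟨i⟩, ⟨j⟩, ⟨(z, s), z.2⟩, ?_⟩
    exact E.pt_eq_iff.2 ⟨c, Q.ofG 1, i, z, s, inj_ofG_one z.2, E.g_ofG_one z.2 _, h1, h2⟩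

/-- The tangent bundle `TE` of the total space of `E`. -/
noncomputable abbrev tangent : Bundle E.total (H × F) := tangentBundle E.total

/-- A vector of `TE` is vertical if each of its lifts to `T(V × F)`, for each chart `V × F`
of `E`, is vertical for the trivial bundle, i.e. is annihilated by the differential of the
projection `V × F → V`. -/
def IsVertical (ξ : E.tangent.Total) : Prop :=
  ∀ (a : Q.Index) (p : (E.total.chart a).V) (η : H × F), E.tangent.pt a p η = ξ →
    fderiv ℝ (Prod.fst : H × F → H) (p : H × F) η = 0

end

/-- The space of vertical vectors at each point of `V × F`, the kernel of the differential of the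
projection `V × F → V` (it is the same subspace of `H × F` at all points). -/
def vertSpace (H : Type u) [NormedAddCommGroup H] [NormedSpace ℝ H]
    (F : Type k) [NormedAddCommGroup F] [NormedSpace ℝ F] : Submodule ℝ (H × F) :=
  LinearMap.ker (ContinuousLinearMap.fst ℝ H F : H × F →ₗ[ℝ] H)

theorem mem_vertSpace (p η : H × F) :
    η ∈ vertSpace H F ↔ fderiv ℝ (Prod.fst : H × F → H) p η = 0 := by
  rw [fderiv_fst]; rfl

theorem inr_mem_vertSpace (η : F) : ((0 : H), η) ∈ vertSpace H F := rfl

/-- The projection `H × F → H × F`, `(ξ, η) ↦ (0, η)`, onto the vertical vectors. -/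
def vertProj (H : Type u) [NormedAddCommGroup H] [NormedSpace ℝ H]
    (F : Type k) [NormedAddCommGroup F] [NormedSpace ℝ F] : H × F →L[ℝ] vertSpace H F :=
  ((ContinuousLinearMap.inr ℝ H F).comp (ContinuousLinearMap.snd ℝ H F)).codRestrict
    (vertSpace H F) fun q => inr_mem_vertSpace q.2

theorem vertProj_coe {η : H × F} (h : η ∈ vertSpace H F) : (vertProj H F η : H × F) = η := by
  obtain ⟨a, b⟩ := η
  obtain rfl : a = 0 := h
  rfl

theorem fderiv_injFun_vert {a b} (i : Q.Inj a b) {p : H × F} (hp : p ∈ E.totV a) {η : H × F}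
    (h : η ∈ vertSpace H F) : fderiv ℝ (E.injFun i) p η ∈ vertSpace H F := by
  have hd : DifferentiableAt ℝ (E.injFun i) p :=
    ((E.injFun_smooth i).contDiffAt ((E.totV_isOpen a).mem_nhds hp)).differentiableAt (by simp)
  have h1 : HasFDerivAt (fun q : H × F => (Q.inj i).toFun q.1)
      ((ContinuousLinearMap.fst ℝ H F).comp (fderiv ℝ (E.injFun i) p)) p :=
    (hasFDerivAt_fst (𝕜 := ℝ) (E := H) (F := F) (p := E.injFun i p)).comp p hd.hasFDerivAt
  have h2 : HasFDerivAt (fun q : H × F => (Q.inj i).toFun q.1)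
      ((fderiv ℝ (Q.inj i).toFun p.1).comp (ContinuousLinearMap.fst ℝ H F)) p :=
    ((((Q.inj i).smooth.contDiffAt ((Q.chart a).isOpen.mem_nhds hp)).differentiableAt
      (by simp)).hasFDerivAt).comp p hasFDerivAt_fst
  have h3 := DFunLike.congr_fun (h1.unique h2) η
  have h4 : η.1 = 0 := h
  change (fderiv ℝ (E.injFun i) p η).1 = 0
  simpa [h4] using h3

section

variable [FiniteDimensional ℝ H] [FiniteDimensional ℝ F]

/-- The vertical tangent bundle `VE → E`, the subbundle of `TE` of vertical vectors: its
transition maps are the restrictions of those of `TE`, see `vertical_g_coe`.  (Over the points of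
the charts, the projection `vertProj` is applied to vectors which are already vertical.) -/
noncomputable def vertical : Bundle E.total (vertSpace H F) where
  g i p := (vertProj H F).comp ((E.tangent.g i p).comp (vertSpace H F).subtypeL)
  smooth i := contDiffOn_const.clm_comp ((E.tangent.smooth i).clm_comp contDiffOn_const)
  invertible {a b} i p hp := by
    have hinj : Function.Injective
        ((vertProj H F).comp ((E.tangent.g i p).comp (vertSpace H F).subtypeL)) := by
      intro η η' h
      have h' := congrArg (Subtype.val : vertSpace H F → H × F) h
      change (vertProj H F (E.tangent.g i p η) : H × F) = vertProj H F (E.tangent.g i p η') at h'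
      have h1 := vertProj_coe (E.fderiv_injFun_vert i hp η.2)
      have h2 := vertProj_coe (E.fderiv_injFun_vert i hp η'.2)
      exact Subtype.ext (E.tangent.g_injective i hp (h1.symm.trans (h'.trans h2)))
    refine ⟨(LinearEquiv.ofInjectiveEndo _ hinj).toContinuousLinearEquiv, ?_⟩
    ext η <;> rfl
  cocycle {a b c} j i p hp := by
    ext1 η
    have h1 := vertProj_coe (E.fderiv_injFun_vert i hp η.2)
    have h2 := E.tangent.g_comp (a := a) (b := b) (c := c) j i hp (η : H × F)
    exact congrArg (vertProj H F) (h2.trans (congrArg (E.tangent.g j (E.injFun i p)) h1.symm))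

theorem vertical_g_coe {a b : Q.Index} (i : Q.Inj a b) {p : H × F} (hp : p ∈ E.totV a)
    (η : vertSpace H F) :
    ((E.vertical.g (a := a) (b := b) i p η : vertSpace H F) : H × F) =
      E.tangent.g (a := a) (b := b) i p (η : H × F) :=
  vertProj_coe (E.fderiv_injFun_vert i hp η.2)

/-- The total space of `VE` is the set of all vertical vectors in `TE`. -/
theorem isVertical_iff (ξ : E.tangent.Total) : E.IsVertical ξ ↔
    ∃ (a : Q.Index) (p : (E.total.chart a).V) (η : vertSpace H F), E.tangent.pt a p η = ξ := by
  constructor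
  · intro h
    induction ξ using Quotient.inductionOn with
    | h q => exact ⟨q.1, q.2.1, ⟨q.2.2, (mem_vertSpace _ _).2 (h q.1 q.2.1 q.2.2 rfl)⟩, rfl⟩
  · rintro ⟨a, p, η, rfl⟩ b q θ h
    obtain ⟨c, i, j, z, s, h1, h2, h3, h4⟩ := E.tangent.pt_eq_iff.1 h.symm
    have hs : s ∈ vertSpace H F := by
      have e := congrArg Prod.fst h2
      have e' : ((fderiv ℝ (E.injFun i) z s).1 : H) = 0 := e.trans η.2
      have hd : DifferentiableAt ℝ (E.injFun i) z :=
        ((E.injFun_smooth i).contDiffAt ((E.totV_isOpen c).mem_nhds z.2)).differentiableAt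
          (by simp)
      have d1 : HasFDerivAt (fun q : H × F => (Q.inj i).toFun q.1)
          ((ContinuousLinearMap.fst ℝ H F).comp (fderiv ℝ (E.injFun i) z)) z :=
        (hasFDerivAt_fst (𝕜 := ℝ) (E := H) (F := F) (p := E.injFun i z)).comp _ hd.hasFDerivAt
      have d2 : HasFDerivAt (fun q : H × F => (Q.inj i).toFun q.1)
          ((fderiv ℝ (Q.inj i).toFun (z : H × F).1).comp (ContinuousLinearMap.fst ℝ H F)) z :=
        ((((Q.inj i).smooth.contDiffAt ((Q.chart c).isOpen.mem_nhds z.2)).differentiableAt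
          (by simp)).hasFDerivAt).comp _ hasFDerivAt_fst
      have d3 : (fderiv ℝ (E.injFun i) z s).1 = fderiv ℝ (Q.inj i).toFun (z : H × F).1 s.1 :=
        DFunLike.congr_fun (d1.unique d2) s
      obtain ⟨A, hA⟩ := (Q.inj i).invertible _ z.2
      rw [e', ← hA] at d3
      exact (A.map_eq_zero_iff).1 d3.symm
    rw [← mem_vertSpace, ← show _ = θ from h4]
    exact E.fderiv_injFun_vert j z.2 hs

/-- The zero section `ι(Q)` as an orbifold: it has one chart `{V, G, x ↦ (x, 0)}` for each chart
`{V, G, π}` of `Q`, where `V` is identified with `V × {0}`, and the injections of `Q`. -/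
noncomputable def zeroOrbifold : Orbifold H (range E.zero) where
  t2 := have := E.t2; inferInstance
  Index := Q.Index
  chart a :=
    { V := (Q.chart a).V
      isOpen := (Q.chart a).isOpen
      isConnected := (Q.chart a).isConnected
      G := (Q.chart a).G
      act := (Q.chart a).act
      act_mapsTo := (Q.chart a).act_mapsTo
      act_smooth := (Q.chart a).act_smooth
      act_one := (Q.chart a).act_one
      act_mul := (Q.chart a).act_mul
      π := fun x => ⟨E.pt a x 0, _, E.zero_π a x⟩
      π_continuous := ((E.pt_continuous a).comp (Continuous.prodMk_left (0 : F))).subtype_mk _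
      π_isOpenMap := by
        have h := (E.zero_isEmbedding.toHomeomorph.isOpenMap).comp (Q.chart a).π_isOpenMap
        convert h using 1
        funext x
        exact Subtype.ext (E.zero_π a x).symm
      π_eq_iff := fun x y => by
        rw [← (Q.chart a).π_eq_iff, ← E.zero_isEmbedding.injective.eq_iff, E.zero_π, E.zero_π]
        exact Subtype.ext_iff }
  Inj := Q.Inj
  inj {a b} i :=
    { toFun := (Q.inj i).toFun
      hom := (Q.inj i).hom
      mapsTo := (Q.inj i).mapsTo
      smooth := (Q.inj i).smooth
      injOn := (Q.inj i).injOn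
      invertible := (Q.inj i).invertible
      π_eq := fun x => Subtype.ext (E.pt_zero_eq _ _ ((Q.inj i).π_eq x))
      hom_injective := (Q.inj i).hom_injective
      equivariant := (Q.inj i).equivariant
      full := (Q.inj i).full }
  comp := Q.comp
  inj_comp := Q.inj_comp
  hom_comp := Q.hom_comp
  comp_assoc := Q.comp_assoc
  ofG := Q.ofG
  inj_ofG := Q.inj_ofG
  hom_ofG := Q.hom_ofG
  ofG_mul := Q.ofG_mul
  one_comp := Q.one_comp
  comp_ofG := Q.comp_ofG
  torsor := Q.torsor
  cover := by
    rintro ⟨_, p, rfl⟩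
    obtain ⟨a, x, rfl⟩ := Q.cover p
    exact ⟨a, x, Subtype.ext (E.zero_π a x).symm⟩
  compatible a b x y h := by
    have h' : (Q.chart a).π x = (Q.chart b).π y := by
      apply E.zero_isEmbedding.injective
      rw [E.zero_π, E.zero_π]
      exact congrArg Subtype.val h
    obtain ⟨c, hi, hj, z, hz⟩ := Q.compatible a b x y h'
    exact ⟨c, hi, hj, z, Subtype.ext (E.pt_zero_eq _ _ hz)⟩

/-- The embedding `ι`, as a map of orbifolds onto its image `ι(Q)`. -/
noncomputable def zeroMap : OrbifoldMap Q E.zeroOrbifold where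
  toFun p := ⟨E.zero p, p, rfl⟩
  continuous := E.zero_continuous.subtype_mk _
  index a := a
  lift _ x := x
  mapsTo _ _ hx := hx
  smooth _ := contDiffOn_id
  π_lift a x := Subtype.ext (E.zero_π a x).symm
  inj i := i
  grp _ := MonoidHom.id _
  inj_comp _ _ := rfl
  inj_ofG _ _ := rfl
  lift_inj _ _ _ := rfl

/-- The inclusion of the suborbifold `ι(Q)` in `E`, lifted by `x ↦ (x, 0)`. -/
noncomputable def zeroInclusion : OrbifoldMap E.zeroOrbifold E.total where
  toFun := Subtype.val
  continuous := continuous_subtype_val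
  index a := a
  lift _ x := (x, 0)
  mapsTo _ _ hx := hx
  smooth _ := contDiffOn_id.prodMk contDiffOn_const
  π_lift _ _ := rfl
  inj i := i
  grp _ := MonoidHom.id _
  inj_comp _ _ := rfl
  inj_ofG _ _ := rfl
  lift_inj i x _ := Prod.ext rfl (map_zero (E.g i x)).symm

/-- The restriction of `VE` to the zero section `ι(Q)`. -/
noncomputable def verticalOnZero : Bundle E.zeroOrbifold (vertSpace H F) :=
  E.vertical.pullback E.zeroInclusion

end

end Bundle

end Basic

end Orbi

namespace Orbi

/-! An injection of charts of `E` has the form `(x, w) ↦ (φ x, g_i(x) w)`. Along a fibre the base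
coordinate stays constant and the fibre coordinate is linear, so the differential at any `(x, w)`
sends `(0, v)` to `(0, g_i(x) v)`. Under the identification `v ↦ (0, v)` of `F` with the vertical
space, the transition maps of `VE` are therefore those of `E`, and the constant family `v ↦ (0, v)`
commutes with all injections. It involves no choice, and group elements acting trivially on the base
need no separate treatment, so bad bundles are covered as well. The computation is
`fderiv_fibrewise_inr`. Since it holds for any pair of a map `f` and a family `T` of linear maps
differentiable at the point, it also yields naturality.

What remains is topology, because total spaces are quotients of disjoint unions of charts. The key
is `tangent_pt_zero_eq_iff`: the gluing of `TE`, restricted to vertical vectors along the zero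
section, is exactly the gluing of `E`. Fibrewise linearity and invertibility keep representatives
over the zero section and vertical. This makes the induced map of total spaces well defined and
injective; combined with openness of the chart maps of `TE` it gives the embedding, and with
`isVertical_iff` the image. -/

/-- The differential of `(y, w) ↦ (f y, T_y w)` on a vertical vector. -/
theorem fderiv_fibrewise_inr {H : Type*} [NormedAddCommGroup H] [NormedSpace ℝ H]
    {F : Type*} [NormedAddCommGroup F] [NormedSpace ℝ F]
    {H' : Type*} [NormedAddCommGroup H'] [NormedSpace ℝ H']
    {F' : Type*} [NormedAddCommGroup F'] [NormedSpace ℝ F']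
    {f : H → H'} {T : H → F →L[ℝ] F'} {x : H} (hf : DifferentiableAt ℝ f x)
    (hT : DifferentiableAt ℝ T x) (w v : F) :
    fderiv ℝ (fun p : H × F => ((f p.1, T p.1 p.2) : H' × F')) (x, w) (0, v) = (0, T x v) := by
  have f1 : HasFDerivAt (Prod.fst : H × F → H) (ContinuousLinearMap.fst ℝ H F) (x, w) :=
    hasFDerivAt_fst
  have f2 : HasFDerivAt (Prod.snd : H × F → F) (ContinuousLinearMap.snd ℝ H F) (x, w) :=
    hasFDerivAt_snd
  have e1 : HasFDerivAt (fun p : H × F => f p.1) _ (x, w) := hf.hasFDerivAt.comp (x, w) f1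
  have e2 : HasFDerivAt (fun p : H × F => T p.1) _ (x, w) := hT.hasFDerivAt.comp (x, w) f1
  have D : HasFDerivAt (fun p : H × F => ((f p.1, T p.1 p.2) : H' × F')) _ (x, w) :=
    e1.prodMk (e2.clm_apply f2)
  -- By the product rule the second component is `T x` applied to the fibre direction, plus the
  -- derivative of `T` in the base direction applied to `w`. The base direction is `0` here, so the
  -- `w`-dependent term disappears.
  rw [D.fderiv]
  simp

/-! ### The vertical lift as a bundle isomorphism. -/

namespace Bundle

variable {H : Type u} [NormedAddCommGroup H] [NormedSpace ℝ H]
  {X : Type v} [TopologicalSpace X] {Q : Orbifold.{u, v, w} H X}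
  {F : Type k} [NormedAddCommGroup F] [NormedSpace ℝ F] (E : Bundle Q F)

/-- This identifies the cocycle of `VE` with that of `E`. The base point `w` in the fibre plays no
role, because the second component of `E.injFun i` is linear in the fibre. -/
theorem fderiv_injFun_inr {a b} (i : Q.Inj a b) {x : H} (hx : x ∈ (Q.chart a).V) (w v : F) :
    fderiv ℝ (E.injFun i) (x, w) (0, v) = (0, E.g i x v) := by
  have hn := (Q.chart a).isOpen.mem_nhds hx
  exact fderiv_fibrewise_inr (((Q.inj i).smooth.contDiffAt hn).differentiableAt (by simp))
    (((E.smooth i).contDiffAt hn).differentiableAt (by simp)) w v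

/-- The isomorphism `v ↦ (0, v)` of the fibre with the space of vertical vectors. -/
def vertEquiv (H : Type u) [NormedAddCommGroup H] [NormedSpace ℝ H]
    (F : Type k) [NormedAddCommGroup F] [NormedSpace ℝ F] : F ≃L[ℝ] vertSpace H F where
  toFun v := ⟨(0, v), inr_mem_vertSpace v⟩
  map_add' v v' := Subtype.ext (by simp)
  map_smul' c v := Subtype.ext (by simp)
  invFun η := (η : H × F).2
  left_inv _ := rfl
  right_inv η := Subtype.ext (Prod.ext (show (0 : H) = (η : H × F).1 from η.2.symm) rfl)
  continuous_toFun := (Continuous.prodMk_right (0 : H)).subtype_mk _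
  continuous_invFun := continuous_snd.comp continuous_subtype_val

theorem exists_pt_eq (e : E.Total) : ∃ (a : Q.Index) (x : (Q.chart a).V) (v : F),
    e = E.pt a x v :=
  Quotient.inductionOn e fun p => ⟨p.1, p.2.1, p.2.2, rfl⟩

variable [FiniteDimensional ℝ H] [FiniteDimensional ℝ F]

/-- `zeroOrbifold` reuses the charts, groups and injections of `Q`, so every condition concerns an
identity map except the homeomorphism onto the image, which holds because `E.proj` is a continuous
left inverse of the zero section. -/
theorem zeroMap_isIso : E.zeroMap.IsIso where
  isHomeomorph := E.zero_isEmbedding.toHomeomorph.isHomeomorph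
  index_bijective := Function.bijective_id
  lift_bijOn _ := bijOn_id _
  lift_invertible a x _ := by
    refine ⟨ContinuousLinearEquiv.refl ℝ H, ?_⟩
    exact (fderiv_id (𝕜 := ℝ) (x := x)).symm
  grp_bijective _ := Function.bijective_id
  inj_bijective _ _ := Function.bijective_id

/-- The bundle map from `E` to the restriction of `VE` to the zero section, which sends `(x, v)`
to the vertical vector `(0, v)` at `(x, 0)`. -/
noncomputable def verticalLift : BundleMap E E.verticalOnZero E.zeroMap where
  fib _ _ := (vertEquiv H F : F →L[ℝ] vertSpace H F)
  smooth _ := contDiffOn_const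
  comm {a b} i x hx := by
    ext1 v
    apply Subtype.ext
    -- On vertical vectors the projection `vertProj` built into `E.vertical` has no effect, so its
    -- transition map at `(x, 0)` may be computed as the differential of `E.injFun i`.
    have h1 := E.vertical_g_coe i (p := (x, 0)) hx (vertEquiv H F v)
    exact ((h1.trans (E.fderiv_injFun_inr i hx 0 v))).symm

theorem verticalLift_isIso : E.verticalLift.IsIso where
  base := E.zeroMap_isIso
  fib_invertible _ _ _ := ⟨vertEquiv H F, rfl⟩

/-! ### The induced map of total spaces. -/

/-- Vectors `(0, s)` at points `(z, 0)` of the zero section are identified in `TE` only with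
such vectors, and as the points `(z, s)` are identified in `E`. -/
theorem tangent_pt_zero_eq_iff {a b : Q.Index} {z : (Q.chart b).V} {s : F}
    {p : (E.total.chart a).V} {η : H × F} :
    E.tangent.pt b ⟨((z : H), (0 : F)), z.2⟩ ((0, s) : H × F) = E.tangent.pt a p η ↔
      (p : H × F).2 = 0 ∧ η.1 = 0 ∧ E.pt b z s = E.pt a ⟨(p : H × F).1, p.2⟩ η.2 := by
  constructor
  · intro h
    obtain ⟨c, i, j, ⟨⟨t, t'⟩, ht⟩, σ, h1, h2, h3, h4⟩ := E.tangent.pt_eq_iff.1 h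
    change E.injFun i (t, t') = ((z : H), (0 : F)) at h1
    change fderiv ℝ (E.injFun i) (t, t') σ = (0, s) at h2
    change E.injFun j (t, t') = (p : H × F) at h3
    change fderiv ℝ (E.injFun j) (t, t') σ = η at h4
    replace ht : t ∈ (Q.chart c).V := ht
    -- The linear map `g_i(t)` is injective, so a common preimage of a point of the zero section
    -- lies on the zero section.
    obtain rfl : t' = 0 :=
      E.g_injective i ht ((congrArg Prod.snd h1).trans (map_zero (E.g i t)).symm)
    -- If `g_i(t) r = s`, then `(0, r)` and `σ` have the same image `(0, s)` under the differential
    -- of `E.injFun i`, which is injective. Hence `σ` is vertical, and `r` is the vector gluing the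
    -- two points in `E`.
    obtain ⟨r, hr⟩ := E.g_surjective i ht s
    obtain rfl : σ = (0, r) := by
      apply E.tangent.g_injective (a := c) (b := b) i (x := (t, 0)) ht
      refine h2.trans ?_
      rw [← hr]
      exact (E.fderiv_injFun_inr i ht 0 r).symm
    rw [E.fderiv_injFun_inr j ht] at h4
    rw [← h4]
    refine ⟨?_, rfl, E.pt_eq_iff.2
      ⟨c, i, j, ⟨t, ht⟩, r, congrArg Prod.fst h1, hr, congrArg Prod.fst h3, rfl⟩⟩
    rw [← h3]
    exact map_zero _
  · rintro ⟨hp, hη, h⟩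
    obtain ⟨c, i, j, t, r, h1, h2, h3, h4⟩ := E.pt_eq_iff.1 h
    -- A gluing of points of `E` through `(t, r)` becomes a gluing in `TE` through the vector `(0,
    -- r)` at `(t, 0)`.
    refine E.tangent.pt_eq_iff.2 ⟨c, i, j, ⟨((t : H), (0 : F)), t.2⟩, ((0, r) : H × F),
      Prod.ext h1 (map_zero _), ?_, Prod.ext h3 ((map_zero _).trans hp.symm), ?_⟩
    · exact (E.fderiv_injFun_inr i t.2 0 r).trans (Prod.ext rfl h2)
    · exact (E.fderiv_injFun_inr j t.2 0 r).trans (Prod.ext hη.symm h4)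

/-- The map of total spaces from `E` to `TE` induced by the vertical lift. -/
noncomputable def verticalLiftTotal : E.Total → E.tangent.Total :=
  Quotient.lift (fun p : E.Pre =>
      E.tangent.pt p.1 ⟨((p.2.1 : H), (0 : F)), p.2.1.2⟩ ((0, p.2.2) : H × F))
    fun _ _ h => E.tangent_pt_zero_eq_iff.2 ⟨rfl, rfl, E.pt_eq_iff.2 h⟩

theorem verticalLiftTotal_pt (a : Q.Index) (x : (Q.chart a).V) (v : F) :
    E.verticalLiftTotal (E.pt a x v) =
      E.tangent.pt a ⟨((x : H), (0 : F)), x.2⟩ ((0, v) : H × F) := rfl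

theorem verticalLiftTotal_continuous : Continuous E.verticalLiftTotal := by
  apply Continuous.quotient_lift
  refine continuous_sigma fun a => ?_
  have h : Continuous fun p : (Q.chart a).V × F =>
      ((⟨((p.1 : H), (0 : F)), p.1.2⟩, (0, p.2)) : (E.total.chart a).V × (H × F)) :=
    (((continuous_subtype_val.comp continuous_fst).prodMk continuous_const).subtype_mk _).prodMk
      (continuous_const.prodMk continuous_snd)
  exact (E.tangent.pt_continuous a).comp h

theorem verticalLiftTotal_injective : Function.Injective E.verticalLiftTotal := by
  intro e e' h
  obtain ⟨a, x, v, rfl⟩ := E.exists_pt_eq e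
  obtain ⟨b, y, w, rfl⟩ := E.exists_pt_eq e'
  exact (E.tangent_pt_zero_eq_iff.1 h).2.2

/-- In a chart the lift is undone by `((x, w), (ξ, η)) ↦ (x, η)`. This need not descend to `TE`:
when `ξ` and `w` are both nonzero, the derivative of `g_i` enters the change of `η`. The argument is
therefore local, using that the chart maps of `TE` are open. -/
theorem verticalLiftTotal_isEmbedding : IsEmbedding E.verticalLiftTotal := by
  refine ⟨isInducing_iff_nhds.2 fun e => le_antisymm
    E.verticalLiftTotal_continuous.continuousAt.le_comap ?_, E.verticalLiftTotal_injective⟩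
  intro U hU
  obtain ⟨a, x, v, rfl⟩ := E.exists_pt_eq e
  have hc : Continuous fun q : E.tangent.totV a =>
      E.pt a ⟨q.1.1.1, q.2⟩ q.1.2.2 :=
    (E.pt_continuous a).comp
      (((continuous_fst.comp (continuous_fst.comp continuous_subtype_val)).subtype_mk _).prodMk
        (continuous_snd.comp (continuous_snd.comp continuous_subtype_val)))
  -- The vectors of this chart whose `(x, η)` represents a point of `U` form a neighbourhood, and
  -- their image in `TE` is again one.
  have hO := (E.tangent.pt_isOpenMap a).image_mem_nhds
    (x := ⟨(((x : H), (0 : F)), ((0 : H), v)), x.2⟩) (hc.continuousAt hU)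
  refine Filter.mem_comap.2 ⟨_, hO, ?_⟩
  rintro e' ⟨⟨⟨p, η⟩, hp⟩, hq, h⟩
  obtain ⟨b, z, s, rfl⟩ := E.exists_pt_eq e'
  -- The lift of `e'` has a representative in that neighbourhood. On lifts the local inverse does
  -- not depend on the representative, so it returns `e'` itself, which is thus in `U`.
  rw [(E.tangent_pt_zero_eq_iff.1 h.symm).2.2]
  exact hq

theorem range_verticalLiftTotal :
    range E.verticalLiftTotal = {ξ | E.IsVertical ξ ∧ E.tangent.proj ξ ∈ range E.zero} := by
  ext ξ
  constructor
  · rintro ⟨e, rfl⟩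
    obtain ⟨a, x, v, rfl⟩ := E.exists_pt_eq e
    exact ⟨(E.isVertical_iff _).2 ⟨a, ⟨((x : H), (0 : F)), x.2⟩, vertEquiv H F v, rfl⟩,
      (Q.chart a).π x, E.zero_π a x⟩
  · rintro ⟨hv, q, hq⟩
    obtain ⟨a, p, η, rfl⟩ := (E.isVertical_iff ξ).1 hv
    obtain ⟨b, y, rfl⟩ := Q.cover q
    rw [E.zero_π] at hq
    change E.pt b y 0 = E.pt a ⟨(p : H × F).1, p.2⟩ (p : H × F).2 at hq
    obtain ⟨c, i, j, t, r, h1, h2, h3, h4⟩ := E.pt_eq_iff.1 hq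
    -- Membership in `ι(Q)` is known only through some chart `b`. Passing back along `i` and forward
    -- along `j` by linear maps, the first injective, shows that the fibre coordinate vanishes in
    -- the chart `a` too.
    obtain rfl : r = 0 := E.g_injective i t.2 (h2.trans (map_zero (E.g i t)).symm)
    have hp : (p : H × F).2 = 0 := h4.symm.trans (map_zero _)
    exact ⟨E.pt a ⟨(p : H × F).1, p.2⟩ (η : H × F).2,
      E.tangent_pt_zero_eq_iff.2 ⟨hp, η.2, rfl⟩⟩

end Bundle

end Orbi

/-! ### Assembly of the theorem. -/

/-- There is a family of isomorphisms `Φ` of orbifold vector bundles from `E → Q` to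
`VE|ι(Q) → ι(Q)`, defined for all orbifold vector bundles `E → Q` and covering `ι : Q → ι(Q)`, which
* in each chart `V × F` sends `(x, v)` to the velocity at `t = 0` of the curve `t ↦ (x, t v)`;
* identifies the total space of `E` with the subspace of all vertical vectors in `TE` at points of
  `ι(Q)`;
* is natural: for each morphism `T : E → E'` of orbifold vector bundles over a map `f : Q → Q'`,
  the differential of the map `(y, w) ↦ (f y, T_y w)` of total spaces, restricted to vertical
  vectors at the zero section, corresponds to `T`. -/
theorem mainTheorem5 :
    ∃ Φ : ∀ (H : Type u) [NormedAddCommGroup H] [NormedSpace ℝ H] [FiniteDimensional ℝ H]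
        (X : Type v) [TopologicalSpace X] (Q : Orbi.Orbifold.{u, v, w} H X)
        (F : Type k) [NormedAddCommGroup F] [NormedSpace ℝ F] [FiniteDimensional ℝ F]
        (E : Orbi.Bundle Q F), Orbi.BundleMap E E.verticalOnZero E.zeroMap,
      (∀ (H : Type u) [NormedAddCommGroup H] [NormedSpace ℝ H] [FiniteDimensional ℝ H]
        (X : Type v) [TopologicalSpace X] (Q : Orbi.Orbifold.{u, v, w} H X)
        (F : Type k) [NormedAddCommGroup F] [NormedSpace ℝ F] [FiniteDimensional ℝ F]
        (E : Orbi.Bundle Q F),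
        (Φ H X Q F E).IsIso ∧
        (∀ (a : Q.Index), ∀ x ∈ (Q.chart a).V, ∀ v : F,
          HasDerivAt (fun t : ℝ => ((x, t • v) : H × F))
            ((Φ H X Q F E).fib a x v : H × F) 0) ∧
        (∃ Ψ : E.Total → E.tangent.Total, IsEmbedding Ψ ∧
          range Ψ = {ξ | E.IsVertical ξ ∧ E.tangent.proj ξ ∈ range E.zero} ∧
          ∀ (a : Q.Index) (x : (Q.chart a).V) (v : F),
            Ψ (E.pt a x v) =
              E.tangent.pt a ⟨((x : H), (0 : F)), x.2⟩ ((Φ H X Q F E).fib a x v : H × F))) ∧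
      (∀ (H : Type u) [NormedAddCommGroup H] [NormedSpace ℝ H] [FiniteDimensional ℝ H]
        (X : Type v) [TopologicalSpace X] (Q : Orbi.Orbifold.{u, v, w} H X)
        (F : Type k) [NormedAddCommGroup F] [NormedSpace ℝ F] [FiniteDimensional ℝ F]
        (E : Orbi.Bundle Q F)
        (H' : Type u) [NormedAddCommGroup H'] [NormedSpace ℝ H'] [FiniteDimensional ℝ H']
        (X' : Type v) [TopologicalSpace X'] (Q' : Orbi.Orbifold.{u, v, w} H' X')
        (F' : Type k) [NormedAddCommGroup F'] [NormedSpace ℝ F'] [FiniteDimensional ℝ F']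
        (E' : Orbi.Bundle Q' F') (f : Orbi.OrbifoldMap Q Q') (T : Orbi.BundleMap E E' f)
        (a : Q.Index), ∀ x ∈ (Q.chart a).V, ∀ v : F,
          fderiv ℝ (fun p : H × F => ((f.lift a p.1, T.fib a p.1 p.2) : H' × F')) (x, 0)
              ((Φ H X Q F E).fib a x v : H × F) =
            ((Φ H' X' Q' F' E').fib (f.index a) (f.lift a x) (T.fib a x v) : H' × F')) := by
  refine ⟨fun H _ _ _ X _ Q F _ _ _ E => E.verticalLift, ?_, ?_⟩
  · intro H _ _ _ X _ Q F _ _ _ E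
    refine ⟨E.verticalLift_isIso, fun a x _ v => ?_, E.verticalLiftTotal,
      E.verticalLiftTotal_isEmbedding, E.range_verticalLiftTotal, E.verticalLiftTotal_pt⟩
    have h : HasDerivAt (fun t : ℝ => t • v) v 0 := by
      simpa using (hasDerivAt_id (0 : ℝ)).smul_const v
    exact (hasDerivAt_const (0 : ℝ) x).prodMk h
  · intro H _ _ _ X _ Q F _ _ _ E H' _ _ _ X' _ Q' F' _ _ _ E' f T a x hx v
    have hn := (Q.chart a).isOpen.mem_nhds hx
    -- The fibre maps of both lifts unfold to `v ↦ (0, v)`, so naturality is the differential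
    -- formula at `w = 0`.
    exact Orbi.fderiv_fibrewise_inr (((f.smooth a).contDiffAt hn).differentiableAt (by simp))
      (((T.smooth a).contDiffAt hn).differentiableAt (by simp)) 0 v
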